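/- Let $K$ be a field, $n\ge 0$, and let $S$ be either the formal power series ring $K[[x_1,\dots,x_n]]$ or the polynomial ring $K[x_1,\dots,x_n]$; put $\mathfrak n=(x_1,\dots,x_n)$ and regard $K=S/\mathfrak n$ as an $S$-module. For $f\in\mathfrak n$ and $1\le r\le n$ let $$d^r(f)=\frac{f(0,\dots,0,x_r,\dots,x_n)-f(0,\dots,0,x_{r+1},\dots,x_n)}{x_r}\in S .$$ For a permutation $\sigma$ of $\{1,\dots,n\}$, let $\sigma$ also denote the $K$-algebra automorphism of $S$ with $x_j\mapsto x_{\sigma(j)}$, and put $d^r_\sigma(f)=\sigma\bigl(d^r(\sigma^{-1}(f))\bigr)$. Let $I\subsetneq S$ be a proper ideal, assumed to be graded (for the standard grading) if $S$ is the polynomial ring, and let $G$ be any set of generators of $I$. Let $d_\sigma(I)$ be the ideal of $S$ generated by all $d^r_\sigma(f)$ with $f\in G$ and $1\le r\le n$. Then $I\subseteq d_\sigma(I)$, and for all $i\ge 1$ the natural map $$\operatorname{Tor}_i^S(K,S/I)\longrightarrow \operatorname{Tor}_i^S(K,S/d_\sigma(I))$$ induced by the surjection $S/I\to S/d_\sigma(I)$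 is zero. -/

import Mathlib

open CategoryTheory

universe u

noncomputable section

/-- The homomorphism `Tor_i^S(S/m, S/I) ⟶ Tor_i^S(S/m, S/J)` induced by the canonical surjection
`S/I → S/J`, for ideals `I ≤ J` and `m` of `S`. -/
def torQuotientMap {S : Type u} [CommRing S] (m : Ideal S) {I J : Ideal S} (h : I ≤ J) (i : ℕ) :
    ((Tor (ModuleCat.{u} S) i).obj (ModuleCat.of S (S ⧸ m))).obj (ModuleCat.of S (S ⧸ I)) ⟶
      ((Tor (ModuleCat.{u} S) i).obj (ModuleCat.of S (S ⧸ m))).obj (ModuleCat.of S (S ⧸ J)) :=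
  ((Tor (ModuleCat.{u} S) i).obj (ModuleCat.of S (S ⧸ m))).map
    (ModuleCat.ofHom (Submodule.factor h))

/-! The variables are indexed by `Fin n`, so they are numbered `0, …, n - 1`. -/

namespace PowerSeriesCase

variable {K : Type u} [Field K] {n : ℕ}

/-- The ideal `(x_0, …, x_{n-1})` of the power series ring. -/
def maxIdeal (K : Type u) [Field K] (n : ℕ) : Ideal (MvPowerSeries (Fin n) K) :=
  Ideal.span (Set.range MvPowerSeries.X)

/-- `f(0, …, 0, x_r, …, x_{n-1})`: all variables `x_j` with `j < r` are replaced by zero. -/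
def zeroBelow (r : ℕ) (f : MvPowerSeries (Fin n) K) : MvPowerSeries (Fin n) K :=
  MvPowerSeries.subst
    (fun j : Fin n => if r ≤ (j : ℕ) then (MvPowerSeries.X j : MvPowerSeries (Fin n) K) else 0) f

/-- Division of a power series by the variable `x_i` (the quotient, when `x_i` divides `g`). -/
def divX (i : Fin n) (g : MvPowerSeries (Fin n) K) : MvPowerSeries (Fin n) K :=
  fun m => MvPowerSeries.coeff (m + Finsupp.single i 1) g

/-- `d^r(f) = (f(0, …, 0, x_r, …, x_{n-1}) - f(0, …, 0, x_{r+1}, …, x_{n-1})) / x_r`. -/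
def d (r : Fin n) (f : MvPowerSeries (Fin n) K) : MvPowerSeries (Fin n) K :=
  divX r (zeroBelow r f - zeroBelow (r + 1) f)

/-- `d_σ^r = σ ∘ d^r ∘ σ⁻¹`, where `σ` acts on power series by `x_j ↦ x_{σ(j)}`. -/
def dPerm (σ : Equiv.Perm (Fin n)) (r : Fin n) (f : MvPowerSeries (Fin n) K) :
    MvPowerSeries (Fin n) K :=
  MvPowerSeries.renameEquiv K σ (d r (MvPowerSeries.renameEquiv K σ.symm f))

/-- The ideal generated by all `d_σ^r(f)` with `f` in the set `G` of generators. -/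
def dIdeal (σ : Equiv.Perm (Fin n)) (G : Set (MvPowerSeries (Fin n) K)) :
    Ideal (MvPowerSeries (Fin n) K) :=
  Ideal.span {g | ∃ f ∈ G, ∃ r : Fin n, g = dPerm σ r f}

theorem coeff_zeroBelow (r : ℕ) (f : MvPowerSeries (Fin n) K) (m : Fin n →₀ ℕ) :
    MvPowerSeries.coeff m (zeroBelow r f) =
      if ∀ j : Fin n, (j : ℕ) < r → m j = 0 then MvPowerSeries.coeff m f else 0 := by
  have h : zeroBelow r f =
      MvPowerSeries.rescale (fun j : Fin n => if r ≤ (j : ℕ) then (1 : K) else 0) f := by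
    rw [MvPowerSeries.rescale_eq_subst, zeroBelow]
    congr 1
    funext j
    by_cases hj : r ≤ (j : ℕ) <;> simp [hj]
  rw [h, MvPowerSeries.coeff_rescale]
  split_ifs with hm
  · rw [Finsupp.prod, Finset.prod_eq_one, one_mul]
    intro j hj
    have : r ≤ (j : ℕ) := by
      by_contra hlt
      exact (Finsupp.mem_support_iff.mp hj) (hm j (by omega))
    simp [this]
  · push Not at hm
    obtain ⟨j, hj, hmj⟩ := hm
    rw [Finsupp.prod, Finset.prod_eq_zero (Finsupp.mem_support_iff.mpr hmj), zero_mul]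
    rw [if_neg (by omega), zero_pow hmj]

/-- The quotient defining `d^r(f)` is exact. -/
theorem X_mul_d (r : Fin n) (f : MvPowerSeries (Fin n) K) :
    MvPowerSeries.X r * d r f = zeroBelow r f - zeroBelow (r + 1) f := by
  have hd : MvPowerSeries.X r ∣ zeroBelow r f - zeroBelow (r + 1) f := by
    rw [MvPowerSeries.X_dvd_iff]
    intro m hm
    rw [map_sub, coeff_zeroBelow, coeff_zeroBelow, sub_eq_zero]
    congr 1
    refine propext ⟨fun h j hj => ?_, fun h j hj => h j (by omega)⟩
    by_cases hjr : j = r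
    · rw [hjr, hm]
    · exact h j (by have := Fin.val_ne_of_ne hjr; omega)
  obtain ⟨q, hq⟩ := hd
  have : d r f = q := by
    ext m
    change MvPowerSeries.coeff (m + Finsupp.single r 1) (zeroBelow r f - zeroBelow (r + 1) f) = _
    rw [hq, MvPowerSeries.X, add_comm, MvPowerSeries.coeff_add_monomial_mul, one_mul]
  rw [this, hq]

end PowerSeriesCase

namespace PolynomialCase

variable {K : Type u} [Field K] {n : ℕ}

attribute [local instance] MvPolynomial.gradedAlgebra

/-- Graded ideals with respect to the standard grading, where each variable has degree one. -/
def IsGraded (I : Ideal (MvPolynomial (Fin n) K)) : Prop :=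
  I.IsHomogeneous (MvPolynomial.homogeneousSubmodule (Fin n) K)

/-- The ideal `(x_0, …, x_{n-1})` of the polynomial ring. -/
def maxIdeal (K : Type u) [Field K] (n : ℕ) : Ideal (MvPolynomial (Fin n) K) :=
  Ideal.span (Set.range MvPolynomial.X)

/-- `f(0, …, 0, x_r, …, x_{n-1})`: all variables `x_j` with `j < r` are replaced by zero. -/
def zeroBelow (r : ℕ) (f : MvPolynomial (Fin n) K) : MvPolynomial (Fin n) K :=
  MvPolynomial.aeval
    (fun j : Fin n => if r ≤ (j : ℕ) then (MvPolynomial.X j : MvPolynomial (Fin n) K) else 0) f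

/-- `d^r(f) = (f(0, …, 0, x_r, …, x_{n-1}) - f(0, …, 0, x_{r+1}, …, x_{n-1})) / x_r`. -/
def d (r : Fin n) (f : MvPolynomial (Fin n) K) : MvPolynomial (Fin n) K :=
  (zeroBelow r f - zeroBelow (r + 1) f).divMonomial (Finsupp.single r 1)

/-- `d_σ^r = σ ∘ d^r ∘ σ⁻¹`, where `σ` acts on polynomials by `x_j ↦ x_{σ(j)}`. -/
def dPerm (σ : Equiv.Perm (Fin n)) (r : Fin n) (f : MvPolynomial (Fin n) K) :
    MvPolynomial (Fin n) K :=
  MvPolynomial.renameEquiv K σ (d r (MvPolynomial.renameEquiv K σ.symm f))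

/-- The ideal generated by all `d_σ^r(f)` with `f` in the set `G` of generators. -/
def dIdeal (σ : Equiv.Perm (Fin n)) (G : Set (MvPolynomial (Fin n) K)) :
    Ideal (MvPolynomial (Fin n) K) :=
  Ideal.span {g | ∃ f ∈ G, ∃ r : Fin n, g = dPerm σ r f}

/-- The quotient defining `d^r(f)` is exact. -/
theorem X_mul_d (r : Fin n) (f : MvPolynomial (Fin n) K) :
    MvPolynomial.X r * d r f = zeroBelow r f - zeroBelow (r + 1) f := by
  have hd : MvPolynomial.X r ∣ zeroBelow r f - zeroBelow (r + 1) f := by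
    induction f using MvPolynomial.induction_on with
    | C a => simp [zeroBelow]
    | add p q hp hq =>
      have h := dvd_add hp hq
      simp only [zeroBelow, map_add] at h ⊢
      convert h using 1
      ring
    | mul_X p j hp =>
      simp only [zeroBelow, map_mul, MvPolynomial.aeval_X] at hp ⊢
      by_cases hjr : j = r
      · subst hjr
        simp
      · have hiff : ((r : ℕ) + 1 ≤ (j : ℕ)) ↔ ((r : ℕ) ≤ (j : ℕ)) := by
          have := Fin.val_ne_of_ne hjr
          omega
        simp only [hiff]
        rw [← sub_mul]
        exact dvd_mul_of_dvd_left hp _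
  obtain ⟨q, hq⟩ := hd
  rw [d, hq, MvPolynomial.X_mul_divMonomial]

end PolynomialCase

end

/-! `Tor(K, -)` can be read off the Koszul complex of the variables, taken in the order `σ`. On the
Koszul complex of `S`, the operators `D r` assemble into a contracting homotopy `h` with `∂h + h∂ =
id` on chains without degree-zero part (`koszulDiff_homotopy_add_of_empty`). It is additive but not
`S`-linear. By a twisted Leibniz rule it carries chains with coefficients in `I` to chains with
coefficients in `d_σ(I)` (`D_mem`). If `t` lifts a positive-degree cycle modulo `I`, then `∂t` has
coefficients in `I`, so `t = ∂ht + h∂t` is a boundary modulo `d_σ(I)` (`koszulTrivial_factor`).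

To pass to the derived functor, which resolves the second argument, the same homotopy shows that
projective modules are Koszul acyclic. A zigzag between the Koszul complex and projective
resolutions then transfers triviality from Koszul homology to `Tor`
(`exists_koszulDiff_eq_of_koszulTrivial`, `exists_sub_mem_of_koszulTrivial`), with no explicit
comparison isomorphism. -/

section Koszul

/-! ### Koszul complexes with coefficients. -/

variable {S : Type*} [CommRing S] {n : ℕ}

/-- The sign of `j` in `e_j ∧ e_J`: the parity of the number of elements of `J` below `j`. -/
def koszulSign (S : Type*) [CommRing S] (j : Fin n) (J : Finset (Fin n)) : S :=
  (-1) ^ (J.filter (· < j)).card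

theorem koszulSign_of_forall_le {j : Fin n} {J : Finset (Fin n)} (h : ∀ k ∈ J, j ≤ k) :
    koszulSign S j J = 1 := by
  rw [koszulSign, Finset.filter_eq_empty_iff.mpr fun k hk => not_lt.mpr (h k hk)]
  simp

theorem koszulSign_insert_of_lt {j k : Fin n} {J : Finset (Fin n)} (hk : k ∉ J) (h : k < j) :
    koszulSign S j (insert k J) = -koszulSign S j J := by
  rw [koszulSign, koszulSign, Finset.filter_insert, if_pos h,
    Finset.card_insert_of_notMem (by simp [hk]), pow_succ]
  ring

theorem koszulSign_insert_of_gt {j k : Fin n} {J : Finset (Fin n)} (h : j < k) :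
    koszulSign S j (insert k J) = koszulSign S j J := by
  rw [koszulSign, koszulSign, Finset.filter_insert, if_neg h.le.not_gt]

theorem koszulSign_mul_koszulSign_insert {j k : Fin n} {J : Finset (Fin n)} (hj : j ∉ J)
    (hk : k ∉ J) (h : j ≠ k) :
    koszulSign S j J * koszulSign S k (insert j J) =
      -(koszulSign S k J * koszulSign S j (insert k J)) := by
  rcases lt_or_gt_of_ne h with h | h
  · rw [koszulSign_insert_of_lt hj h, koszulSign_insert_of_gt h]
    ring
  · rw [koszulSign_insert_of_lt hk h, koszulSign_insert_of_gt h]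
    ring

variable (y : Fin n → S) {M M' : Type*} [AddCommGroup M] [Module S M] [AddCommGroup M']
  [Module S M']

/-- The Koszul differential of the sequence `y` with coefficients in `M`. A family `z` indexed by
the finite sets `J` of indices stands for `∑ z_J e_J`. -/
noncomputable def koszulDiff : (Finset (Fin n) → M) →ₗ[S] (Finset (Fin n) → M) :=
  LinearMap.pi fun J => ∑ j ∈ Jᶜ, (koszulSign S j J * y j) • LinearMap.proj (insert j J)

theorem koszulDiff_apply (z : Finset (Fin n) → M) (J : Finset (Fin n)) :
    koszulDiff y z J = ∑ j ∈ Jᶜ, (koszulSign S j J * y j) • z (insert j J) := by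
  simp [koszulDiff, LinearMap.sum_apply]

theorem koszulDiff_empty (z : Finset (Fin n) → M) :
    koszulDiff y z ∅ = ∑ j, y j • z {j} := by
  simp [koszulDiff_apply, koszulSign_of_forall_le]

theorem koszulDiff_koszulDiff (z : Finset (Fin n) → M) : koszulDiff y (koszulDiff y z) = 0 := by
  funext J
  simp only [koszulDiff_apply, Finset.smul_sum, Pi.zero_apply]
  rw [Finset.sum_sigma']
  refine Finset.sum_involution (fun p _ => ⟨p.2, p.1⟩) ?_ ?_ ?_ ?_
  · rintro ⟨j, k⟩ h
    simp only [Finset.mem_sigma, Finset.mem_compl, Finset.mem_insert, not_or] at h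
    dsimp only
    rw [Finset.insert_comm k j, smul_smul, smul_smul, ← add_smul]
    have := koszulSign_mul_koszulSign_insert (S := S) h.1 h.2.2 (Ne.symm h.2.1)
    convert zero_smul S _
    linear_combination y j * y k * this
  · rintro ⟨j, k⟩ h _ e
    simp only [Finset.mem_sigma, Finset.mem_compl, Finset.mem_insert, not_or] at h
    exact h.2.1 (congrArg Sigma.fst e)
  · rintro ⟨j, k⟩ h
    simp only [Finset.mem_sigma, Finset.mem_compl, Finset.mem_insert, not_or] at h ⊢
    exact ⟨h.2.2, Ne.symm h.2.1, h.1⟩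
  · rintro ⟨j, k⟩ _
    rfl

theorem koszulDiff_map (g : M →ₗ[S] M') (z : Finset (Fin n) → M) :
    koszulDiff y (fun J => g (z J)) = fun J => g (koszulDiff y z J) := by
  funext J
  simp [koszulDiff_apply]

variable (M) in
/-- The Koszul complex with coefficients in `M` is exact in positive degrees, and in degree zero
its boundaries contain every cycle that vanishes there. -/
def KoszulAcyclic : Prop :=
  ∀ z : Finset (Fin n) → M, koszulDiff y z = 0 → z ∅ = 0 →
    ∃ v : Finset (Fin n) → M, v ∅ = 0 ∧ koszulDiff y v = z

/-- The map induced by `g` on Koszul homology vanishes in positive degrees. -/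
def KoszulTrivial (g : M →ₗ[S] M') : Prop :=
  ∀ z : Finset (Fin n) → M, koszulDiff y z = 0 → z ∅ = 0 →
    ∃ v : Finset (Fin n) → M', koszulDiff y v = fun J => g (z J)

variable {y}

theorem KoszulAcyclic.of_retract (h : KoszulAcyclic y M') (i : M →ₗ[S] M') (p : M' →ₗ[S] M)
    (hpi : ∀ m, p (i m) = m) : KoszulAcyclic y M := by
  intro z hz hz0
  obtain ⟨v, hv0, hv⟩ := h (fun J => i (z J))
    (by rw [koszulDiff_map, hz]; simp [Pi.zero_def]) (by simp [hz0])
  refine ⟨fun J => p (v J), by simp [hv0], ?_⟩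
  rw [koszulDiff_map, hv]
  simp [hpi]

/-! ### Successive quotients and the contracting homotopy. -/

/-- Ring endomorphisms `E r` that kill the variables `y j` with `j < r` and fix the others, with
the quotients `D r f = (E r f - E (r + 1) f) / y r`. -/
structure SuccessiveQuotients (y : Fin n → S) where
  E : ℕ → S →+* S
  D : Fin n → S → S
  E_zero : ∀ f, E 0 f = f
  E_var : ∀ (r : ℕ) (j : Fin n), E r (y j) = if r ≤ (j : ℕ) then y j else 0
  mul_D : ∀ (r : Fin n) (f : S), y r * D r f = E r f - E (r + 1) f
  regular : ∀ r, IsLeftRegular (y r)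

namespace SuccessiveQuotients

variable (Q : SuccessiveQuotients y)

include Q

/-- Since `y r` is regular, `mul_D` determines `D r`; every identity for `D r` below is checked
after multiplication by `y r`. -/
theorem D_eq_of_mul_eq {r : Fin n} {f g : S} (h : Q.E r f - Q.E (r + 1) f = y r * g) :
    Q.D r f = g :=
  Q.regular r ((Q.mul_D r f).trans h)

theorem D_zero (r : Fin n) : Q.D r 0 = 0 := Q.D_eq_of_mul_eq (by simp)

theorem D_add (r : Fin n) (f g : S) : Q.D r (f + g) = Q.D r f + Q.D r g :=
  Q.D_eq_of_mul_eq (by rw [mul_add, Q.mul_D, Q.mul_D, map_add, map_add]; ring)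

theorem D_sum {α : Type*} (r : Fin n) (s : Finset α) (f : α → S) :
    Q.D r (∑ a ∈ s, f a) = ∑ a ∈ s, Q.D r (f a) :=
  map_sum (⟨⟨Q.D r, Q.D_zero r⟩, Q.D_add r⟩ : S →+ S) f s

theorem D_mul (r : Fin n) (f g : S) :
    Q.D r (f * g) = Q.E r f * Q.D r g + Q.D r f * Q.E (r + 1) g :=
  Q.D_eq_of_mul_eq (by
    rw [mul_add, mul_left_comm, ← mul_assoc (y r), Q.mul_D, Q.mul_D, map_mul, map_mul]; ring)

theorem D_koszulSign_mul (r j : Fin n) (J : Finset (Fin n)) (f : S) :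
    Q.D r (koszulSign S j J * f) = koszulSign S j J * Q.D r f :=
  Q.D_eq_of_mul_eq (by
    rw [mul_left_comm, Q.mul_D, map_mul, map_mul, koszulSign, map_pow, map_pow, map_neg, map_neg,
      map_one, map_one]; ring)

theorem D_var_mul_self (r : Fin n) (f : S) : Q.D r (y r * f) = Q.E r f :=
  Q.D_eq_of_mul_eq (by simp [Q.E_var])

theorem D_var_mul_of_lt {r j : Fin n} (h : j < r) (f : S) : Q.D r (y j * f) = 0 := by
  have h' : (j : ℕ) < r := h
  refine Q.D_eq_of_mul_eq ?_
  rw [map_mul, map_mul, Q.E_var, Q.E_var, if_neg (by omega), if_neg (by omega)]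
  ring

theorem D_var_mul_of_gt {r j : Fin n} (h : r < j) (f : S) :
    Q.D r (y j * f) = y j * Q.D r f := by
  have h' : (r : ℕ) < j := h
  refine Q.D_eq_of_mul_eq ?_
  rw [mul_left_comm, Q.mul_D, map_mul, map_mul, Q.E_var, Q.E_var, if_pos h'.le,
    if_pos (Nat.succ_le_of_lt h')]
  ring

theorem E_sub_E_eq_sum (a b : ℕ) (hab : a ≤ b) (hb : b ≤ n) (f : S) :
    Q.E a f - Q.E b f =
      ∑ j : Fin n, if a ≤ (j : ℕ) ∧ (j : ℕ) < b then y j * Q.D j f else 0 := by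
  induction b, hab using Nat.le_induction with
  | base =>
    rw [sub_self, Finset.sum_eq_zero]
    intro j _
    rw [if_neg (by omega)]
  | succ b hab ih =>
    have := ih (by omega)
    have hsingle := Finset.sum_ite_eq' Finset.univ (⟨b, hb⟩ : Fin n) (fun j => y j * Q.D j f)
    rw [if_pos (Finset.mem_univ _)] at hsingle
    rw [← sub_add_sub_cancel _ (Q.E b f), this, ← Q.mul_D ⟨b, hb⟩, ← hsingle,
      ← Finset.sum_add_distrib]
    refine Finset.sum_congr rfl fun j _ => ?_
    have hj : j = ⟨b, hb⟩ ↔ (j : ℕ) = b := Fin.ext_iff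
    by_cases h : (j : ℕ) = b
    · rw [if_neg (by omega), if_pos (hj.mpr h), if_pos (by omega), zero_add]
    · rw [if_neg (mt hj.mp h), add_zero]
      congr 1
      simp only [eq_iff_iff]
      omega

/-- The contracting homotopy of the Koszul complex of `S`. -/
noncomputable def homotopy (z : Finset (Fin n) → S) (J : Finset (Fin n)) : S :=
  if h : J.Nonempty then Q.D (J.min' h) (z (J.erase (J.min' h))) else 0

theorem homotopy_empty (z : Finset (Fin n) → S) : Q.homotopy z ∅ = 0 := by
  simp [homotopy]

theorem homotopy_of_min {J : Finset (Fin n)} {r : Fin n} (hr : r ∈ J) (hmin : ∀ k ∈ J, r ≤ k)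
    (z : Finset (Fin n) → S) : Q.homotopy z J = Q.D r (z (J.erase r)) := by
  have hJ : J.Nonempty := ⟨r, hr⟩
  have : J.min' hJ = r := le_antisymm (J.min'_le r hr) (hmin _ (J.min'_mem hJ))
  rw [homotopy, dif_pos hJ, this]

/-- Let `r = min J`. The index `r` in `∂z` contributes `E r (z J)`, and each `j < r` contributes `y
j * D j (z J)` through `∂h`. Terms with `j > r` cancel in pairs. The rest telescopes to `E 0 (z J) =
z J`. -/
theorem koszulDiff_homotopy_add (z : Finset (Fin n) → S) {J : Finset (Fin n)} (hJ : J.Nonempty) :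
    koszulDiff y (Q.homotopy z) J + Q.homotopy (koszulDiff y z) J = z J := by
  obtain ⟨r, hr, hmin⟩ : ∃ r ∈ J, ∀ k ∈ J, r ≤ k :=
    ⟨J.min' hJ, J.min'_mem hJ, fun k hk => J.min'_le k hk⟩
  have hcompl : (J.erase r)ᶜ = insert r Jᶜ := by rw [Finset.compl_erase]
  rw [Q.homotopy_of_min hr hmin, koszulDiff_apply, koszulDiff_apply, hcompl,
    Finset.sum_insert (by simp [hr]), Q.D_add, Q.D_sum, Finset.insert_erase hr,
    koszulSign_of_forall_le fun k hk => hmin k (Finset.mem_of_mem_erase hk), one_mul, smul_eq_mul,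
    Q.D_var_mul_self, add_left_comm, ← Finset.sum_add_distrib]
  have hterm : ∀ j ∈ Jᶜ, (koszulSign S j J * y j) • Q.homotopy z (insert j J) +
      Q.D r ((koszulSign S j (J.erase r) * y j) • z (insert j (J.erase r))) =
        if 0 ≤ (j : ℕ) ∧ (j : ℕ) < r then y j * Q.D j (z J) else 0 := by
    intro j hj
    rw [Finset.mem_compl] at hj
    have hjr : j ≠ r := fun h => hj (h ▸ hr)
    rw [smul_eq_mul, smul_eq_mul, mul_assoc (koszulSign S j (J.erase r)), Q.D_koszulSign_mul]
    rcases lt_or_gt_of_ne hjr with h | h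
    · have hjmin : ∀ k ∈ J, j ≤ k := fun k hk => h.le.trans (hmin k hk)
      rw [if_pos ⟨Nat.zero_le _, h⟩, Q.D_var_mul_of_lt h, mul_zero, add_zero,
        koszulSign_of_forall_le hjmin, one_mul,
        Q.homotopy_of_min (Finset.mem_insert_self j J) (by simpa using hjmin),
        Finset.erase_insert hj]
    · rw [if_neg (fun h' => h.not_gt h'.2), Q.D_var_mul_of_gt h,
        Q.homotopy_of_min (Finset.mem_insert_of_mem hr) (by simpa using ⟨h.le, hmin⟩),
        Finset.erase_insert_of_ne hjr]
      -- Removing the minimum `r < j` from `J` flips the sign; this is what makes the two terms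
      -- cancel.
      have hs : koszulSign S j J = -koszulSign S j (J.erase r) := by
        rw [← koszulSign_insert_of_lt (Finset.notMem_erase r J) h, Finset.insert_erase hr]
      rw [hs]
      ring
  have hsum := Q.E_sub_E_eq_sum 0 r (Nat.zero_le _) r.isLt.le (z J)
  rw [Q.E_zero, ← Finset.sum_subset (Finset.subset_univ Jᶜ)] at hsum
  · rw [Finset.sum_congr rfl hterm, ← hsum]
    ring
  · intro j _ hj
    rw [Finset.mem_compl, not_not] at hj
    rw [if_neg fun h => (hmin j hj).not_gt h.2]

theorem koszulDiff_homotopy_add_of_empty (z : Finset (Fin n) → S) (hz : z ∅ = 0) :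
    koszulDiff y (Q.homotopy z) + Q.homotopy (koszulDiff y z) = z := by
  funext J
  rw [Pi.add_apply]
  rcases J.eq_empty_or_nonempty with rfl | hJ
  · rw [Q.homotopy_empty, koszulDiff_empty, hz, add_zero]
    refine Finset.sum_eq_zero fun j _ => ?_
    rw [Q.homotopy_of_min (Finset.mem_singleton_self j) (by simp), Finset.erase_singleton, hz,
      Q.D_zero, smul_zero]
  · exact Q.koszulDiff_homotopy_add z hJ

theorem koszulAcyclic_finsupp (ι : Type*) : KoszulAcyclic y (ι →₀ S) := by
  intro z hz hz0
  -- The homotopy, applied in each coordinate; `D_zero` keeps supports finite.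
  refine ⟨fun J => if h : J.Nonempty then
    (z (J.erase (J.min' h))).mapRange (Q.D (J.min' h)) (Q.D_zero _) else 0, by simp, ?_⟩
  funext J
  ext i
  have hcomp : ∀ w : Finset (Fin n) → ι →₀ S,
      (koszulDiff y w J) i = koszulDiff y (fun J => w J i) J := fun w =>
    (congrFun (koszulDiff_map y (Finsupp.lapply i) w) J).symm
  have hzi : koszulDiff y (fun J => z J i) = 0 := by
    rw [show (fun J => z J i) = fun J => Finsupp.lapply (R := S) i (z J) from rfl,
      koszulDiff_map, hz]
    simp [Pi.zero_def]
  have key := congrFun (Q.koszulDiff_homotopy_add_of_empty (fun J => z J i) (by simp [hz0])) J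
  have hzero : Q.homotopy 0 J = 0 := by
    unfold homotopy
    split_ifs <;> simp [Q.D_zero]
  rw [hzi, Pi.add_apply, hzero, add_zero] at key
  rw [hcomp, ← key]
  refine congrArg (fun w => koszulDiff y w J) (funext fun A => ?_)
  unfold homotopy
  split_ifs <;> simp

theorem koszulAcyclic_of_projective (P : Type*) [AddCommGroup P] [Module S P]
    [Module.Projective S P] : KoszulAcyclic y P := by
  obtain ⟨s, hs⟩ := Module.projective_def'.mp (inferInstance : Module.Projective S P)
  exact (Q.koszulAcyclic_finsupp P).of_retract s (Finsupp.linearCombination S id)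
    fun m => LinearMap.congr_fun hs m

/-! ### The ideal of quotients and triviality on Koszul homology. -/

theorem eq_sum_of_E_eq_zero {f : S} (hf : Q.E n f = 0) (r : ℕ) (hr : r ≤ n) :
    Q.E r f = ∑ j : Fin n, if r ≤ (j : ℕ) ∧ (j : ℕ) < n then y j * Q.D j f else 0 := by
  rw [← Q.E_sub_E_eq_sum r n hr le_rfl, hf, sub_zero]

theorem E_mem {G : Set S} {f : S} (hfG : f ∈ G) (hf : Q.E n f = 0) (r : ℕ) (hr : r ≤ n) :
    Q.E r f ∈ Ideal.span {g | ∃ f ∈ G, ∃ r, g = Q.D r f} := by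
  rw [Q.eq_sum_of_E_eq_zero hf r hr]
  refine Ideal.sum_mem _ fun j _ => ?_
  split_ifs
  · exact Ideal.mul_mem_left _ _ (Ideal.subset_span ⟨f, hfG, j, rfl⟩)
  · exact Ideal.zero_mem _

theorem span_le {G : Set S} (hG : ∀ f ∈ G, Q.E n f = 0) :
    Ideal.span G ≤ Ideal.span {g | ∃ f ∈ G, ∃ r, g = Q.D r f} :=
  Ideal.span_le.mpr fun f hf => by
    simpa [Q.E_zero] using Q.E_mem hf (hG f hf) 0 (Nat.zero_le _)

/-- This makes the choice of generators harmless: in `D r (a * f) = E r a * D r f + D r a * E (r +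
1) f`, the factor `E (r + 1) f` also lies in the target ideal. -/
theorem D_mem {G : Set S} (hG : ∀ f ∈ G, Q.E n f = 0) (r : Fin n) {f : S}
    (hf : f ∈ Ideal.span G) : Q.D r f ∈ Ideal.span {g | ∃ f ∈ G, ∃ r, g = Q.D r f} := by
  induction hf using Submodule.span_induction with
  | mem f hf => exact Ideal.subset_span ⟨f, hf, r, rfl⟩
  | zero => rw [Q.D_zero]; exact Ideal.zero_mem _
  | add f g _ _ hf hg => rw [Q.D_add]; exact Ideal.add_mem _ hf hg
  | smul a f hfG hf =>
    rw [smul_eq_mul, Q.D_mul]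
    refine Ideal.add_mem _ (Ideal.mul_mem_left _ _ hf) (Ideal.mul_mem_left _ _ ?_)
    -- `E (r + 1) f = E r f - y r * D r f`, and `E r f` is handled through the generators because `E
    -- r` is multiplicative.
    have := Ideal.sub_mem _ (a := Q.E r f) (b := y r * Q.D r f) ?_ (Ideal.mul_mem_left _ _ hf)
    · rwa [Q.mul_D, sub_sub_cancel] at this
    · clear hf
      induction hfG using Submodule.span_induction with
      | mem f hf => exact Q.E_mem hf (hG f hf) r r.isLt.le
      | zero => rw [map_zero]; exact Ideal.zero_mem _
      | add f g _ _ hf hg => rw [map_add]; exact Ideal.add_mem _ hf hg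
      | smul b f _ hf => rw [smul_eq_mul, map_mul]; exact Ideal.mul_mem_left _ _ hf

theorem koszulTrivial_factor {I J : Ideal S} (h : I ≤ J) (hD : ∀ r, ∀ f ∈ I, Q.D r f ∈ J) :
    KoszulTrivial y (Submodule.factor h) := by
  intro z hz hz0
  obtain ⟨t, ht0, ht⟩ : ∃ t : Finset (Fin n) → S, t ∅ = 0 ∧
      ∀ A, Submodule.Quotient.mk (t A) = z A := by
    choose t ht using fun A => Submodule.Quotient.mk_surjective I (z A)
    -- The homotopy identity needs the lift itself, not just its class, to vanish at `∅`.
    refine ⟨Function.update t ∅ 0, by simp, fun A => ?_⟩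
    by_cases hA : A = ∅
    · subst hA
      simp [hz0]
    · rw [Function.update_of_ne hA, ht]
  have hdt : ∀ A, koszulDiff y t A ∈ I := by
    intro A
    rw [← Submodule.Quotient.mk_eq_zero, ← Submodule.mkQ_apply,
      ← congrFun (koszulDiff_map y I.mkQ t) A]
    simp only [Submodule.mkQ_apply, ht]
    exact congrFun hz A
  refine ⟨fun A => J.mkQ (Q.homotopy t A), ?_⟩
  rw [koszulDiff_map]
  funext A
  rw [← ht A, ← Submodule.mkQ_apply, Submodule.factor_mk]
  conv_rhs => rw [← Q.koszulDiff_homotopy_add_of_empty t ht0]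
  rw [Pi.add_apply, Submodule.mkQ_apply, Submodule.mkQ_apply, Submodule.Quotient.eq,
    sub_add_cancel_left, neg_mem_iff]
  unfold homotopy
  split_ifs
  · exact hD _ _ (hdt _)
  · exact Ideal.zero_mem _

end SuccessiveQuotients

end Koszul

/-! ### Zigzag between the Koszul complex and resolutions. -/

section Comparison

variable {S : Type*} [CommRing S] {n : ℕ} {y : Fin n → S}
  {P Q : ℕ → Type*} [∀ k, AddCommGroup (P k)] [∀ k, Module S (P k)]
  [∀ k, AddCommGroup (Q k)] [∀ k, Module S (Q k)]
  {M N : Type*} [AddCommGroup M] [Module S M] [AddCommGroup N] [Module S N]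
  {dP : ∀ k, P (k + 1) →ₗ[S] P k} {dQ : ∀ k, Q (k + 1) →ₗ[S] Q k}
  {εP : P 0 →ₗ[S] M} {εQ : Q 0 →ₗ[S] N} {φ : ∀ k, P k →ₗ[S] Q k} {g : M →ₗ[S] N}

/-- A morphism that is trivial on Koszul homology kills, up to boundaries, the Koszul boundaries
among the syzygies of a resolution. -/
theorem exists_koszulDiff_eq_of_koszulTrivial (hg : KoszulTrivial y g)
    (hP : ∀ k, KoszulAcyclic y (P k)) (hdP : ∀ k x, dP k (dP (k + 1) x) = 0)
    (hεP : ∀ x, εP (dP 0 x) = 0) (hdQ : ∀ k, Function.Exact (dQ (k + 1)) (dQ k))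
    (hεQ : Function.Exact (dQ 0) εQ) (hεQs : Function.Surjective εQ)
    (hφ : ∀ k x, φ k (dP k x) = dQ k (φ (k + 1) x)) (hφε : ∀ x, εQ (φ 0 x) = g (εP x))
    (k : ℕ) (z : Finset (Fin n) → P (k + 1)) (v : Finset (Fin n) → P k) (hv : v ∅ = 0)
    (hzv : koszulDiff y v = fun J => dP k (z J)) :
    ∃ w : Finset (Fin n) → Q (k + 1),
      (koszulDiff y fun J => dQ k (w J)) = fun J => φ k (dP k (z J)) := by
  induction k with
  | zero =>
    -- `εP v` is a Koszul cycle in `M`, since `∂v = dP z` and `εP` kills the image of `dP 0`; only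
    -- here is the triviality of `g` used.
    obtain ⟨t, ht⟩ := hg (fun J => εP (v J)) (by rw [koszulDiff_map, hzv]; simp [hεP]; rfl)
      (by simp [hv])
    choose s hs using fun J => hεQs (t J)
    have hker : ∀ J, εQ (φ 0 (v J) - koszulDiff y s J) = 0 := by
      intro J
      rw [map_sub, ← congrFun (koszulDiff_map y εQ s) J]
      simp only [hs, ht, hφε, sub_self]
    choose w hw using fun J => (hεQ _).mp (hker J)
    refine ⟨w, ?_⟩
    rw [funext hw]
    change koszulDiff y ((fun J => φ 0 (v J)) - koszulDiff y s) = _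
    rw [map_sub, koszulDiff_koszulDiff, sub_zero, koszulDiff_map, hzv]
  | succ k ih =>
    -- Going down one step of the resolution raises the Koszul degree by one: `dP v` is a Koszul
    -- cycle, hence some `∂v'`, and the induction hypothesis applies to `(v, v')`.
    have hdv : (koszulDiff y fun J => dP k (v J)) = 0 := by
      rw [koszulDiff_map, hzv]
      simp [hdP]
      rfl
    obtain ⟨v', hv', hv'd⟩ := hP k _ hdv (by simp [hv])
    obtain ⟨s, hs⟩ := ih v v' hv' hv'd
    have hker : ∀ J, dQ k (φ (k + 1) (v J) - koszulDiff y s J) = 0 := by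
      intro J
      rw [map_sub, ← congrFun (koszulDiff_map y (dQ k) s) J, hs]
      exact sub_eq_zero.mpr (hφ k (v J)).symm
    choose w hw using fun J => (hdQ k _).mp (hker J)
    refine ⟨w, ?_⟩
    rw [funext hw]
    change koszulDiff y ((fun J => φ (k + 1) (v J)) - koszulDiff y s) = _
    rw [map_sub, koszulDiff_koszulDiff, sub_zero, koszulDiff_map, hzv]

theorem mem_span_range_smul_top_iff (x : M) :
    x ∈ Ideal.span (Set.range y) • (⊤ : Submodule S M) ↔ ∃ c : Fin n → M, ∑ j, y j • c j = x := by
  constructor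
  · intro hx
    induction hx using Submodule.smul_induction_on' with
    | smul a ha m _ =>
      obtain ⟨b, rfl⟩ := (Ideal.mem_span_range_iff_exists_fun).mp ha
      refine ⟨fun j => b j • m, ?_⟩
      rw [Finset.sum_smul]
      exact Finset.sum_congr rfl fun j _ => by rw [smul_smul, mul_comm]
    | add a _ b _ ha hb =>
      obtain ⟨c, rfl⟩ := ha
      obtain ⟨c', rfl⟩ := hb
      exact ⟨c + c', by simp [smul_add, Finset.sum_add_distrib]⟩
  · rintro ⟨c, rfl⟩
    exact Submodule.sum_mem _ fun j _ =>
      Submodule.smul_mem_smul (Ideal.subset_span ⟨j, rfl⟩) Submodule.mem_top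

/-- Writing `dP x = ∑ y j • c j` starts the zigzag. It returns `w` such that `φ x - ∂w` at `∅` is a
cycle, hence some `dQ q`, while `∂w` at `∅` is a combination of the `y j`. -/
theorem exists_sub_mem_of_koszulTrivial (hg : KoszulTrivial y g)
    (hP : ∀ k, KoszulAcyclic y (P k)) (hdP : ∀ k x, dP k (dP (k + 1) x) = 0)
    (hεP : ∀ x, εP (dP 0 x) = 0) (hdQ : ∀ k, Function.Exact (dQ (k + 1)) (dQ k))
    (hεQ : Function.Exact (dQ 0) εQ) (hεQs : Function.Surjective εQ)
    (hφ : ∀ k x, φ k (dP k x) = dQ k (φ (k + 1) x)) (hφε : ∀ x, εQ (φ 0 x) = g (εP x))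
    (k : ℕ) (x : P (k + 1)) (hx : dP k x ∈ Ideal.span (Set.range y) • (⊤ : Submodule S (P k))) :
    ∃ q : Q (k + 2), φ (k + 1) x - dQ (k + 1) q ∈
      Ideal.span (Set.range y) • (⊤ : Submodule S (Q (k + 1))) := by
  obtain ⟨c, hc⟩ := (mem_span_range_smul_top_iff _).mp hx
  -- `x` is placed in Koszul degree zero and the `c j` in degree one.
  obtain ⟨w, hw⟩ := exists_koszulDiff_eq_of_koszulTrivial hg hP hdP hεP hdQ hεQ hεQs hφ hφε k
    (fun J => if J = ∅ then x else 0) (fun J => ∑ j, if J = {j} then c j else 0)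
    (by simp [eq_comm (a := (∅ : Finset (Fin n)))]) (by
      funext J
      rcases J.eq_empty_or_nonempty with rfl | hJ
      · rw [koszulDiff_empty]
        simp [hc]
      · rw [koszulDiff_apply, if_neg hJ.ne_empty, map_zero]
        refine Finset.sum_eq_zero fun j hj => ?_
        rw [Finset.sum_eq_zero, smul_zero]
        intro i _
        rw [if_neg]
        intro h
        obtain ⟨a, ha⟩ := hJ
        have hai : a = i := by
          rw [← Finset.mem_singleton, ← h]; exact Finset.mem_insert_of_mem ha
        have hji : j = i := by
          rw [← Finset.mem_singleton, ← h]; exact Finset.mem_insert_self _ _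
        exact Finset.mem_compl.mp hj (by rwa [hji, ← hai]))
  have hw0 := congrFun hw ∅
  rw [koszulDiff_map] at hw0
  dsimp only at hw0
  rw [if_pos rfl, hφ] at hw0
  obtain ⟨q, hq⟩ := (hdQ k (φ (k + 1) x - koszulDiff y w ∅)).mp (by rw [map_sub, hw0, sub_self])
  refine ⟨q, ?_⟩
  rw [hq, sub_sub_cancel, koszulDiff_empty]
  exact (mem_span_range_smul_top_iff _).mpr ⟨_, rfl⟩

end Comparison

/-! ### Transfer to the derived functor. -/

section Tor

theorem one_tmul_eq_zero_iff {S : Type*} [CommRing S] (I : Ideal S) {M : Type*} [AddCommGroup M]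
    [Module S M] (x : M) :
    (1 : S ⧸ I) ⊗ₜ[S] x = 0 ↔ x ∈ I • (⊤ : Submodule S M) := by
  rw [← (TensorProduct.quotTensorEquivQuotSMul M I).map_eq_zero_iff,
    ← map_one (Ideal.Quotient.mk I), TensorProduct.quotTensorEquivQuotSMul_mk_tmul, one_smul,
    Submodule.Quotient.mk_eq_zero]

theorem exists_one_tmul_eq {S : Type*} [CommRing S] (I : Ideal S) {M : Type*} [AddCommGroup M]
    [Module S M] (t : TensorProduct S (S ⧸ I) M) : ∃ x : M, (1 : S ⧸ I) ⊗ₜ[S] x = t := by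
  induction t using TensorProduct.induction_on with
  | zero => exact ⟨0, TensorProduct.tmul_zero _ _⟩
  | tmul a m =>
    obtain ⟨a, rfl⟩ := Ideal.Quotient.mk_surjective a
    refine ⟨a • m, ?_⟩
    rw [← TensorProduct.smul_tmul, ← map_one (Ideal.Quotient.mk I), ← Ideal.Quotient.mk_eq_mk,
      ← Submodule.Quotient.mk_smul, smul_eq_mul, mul_one]
    rfl
  | add t t' ht ht' =>
    obtain ⟨x, rfl⟩ := ht
    obtain ⟨x', rfl⟩ := ht'
    exact ⟨x + x', TensorProduct.tmul_add _ _ _⟩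

/-- A chain map of module complexes that sends cycles to boundaries is zero on homology. -/
theorem homologyMap_eq_zero_of_forall_cycle {R : Type u} [CommRing R]
    {A B : ChainComplex (ModuleCat.{u} R) ℕ} (f : A ⟶ B) (i : ℕ)
    (h : ∀ x : A.X (i + 1), (A.d (i + 1) i).hom x = 0 →
      ∃ b : B.X (i + 2), (B.d (i + 2) (i + 1)).hom b = (f.f (i + 1)).hom x) :
    HomologicalComplex.homologyMap f (i + 1) = 0 := by
  rw [← cancel_epi (A.homologyπ (i + 1)), HomologicalComplex.homologyπ_naturality,
    Limits.comp_zero]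
  ext c
  obtain ⟨b, hb⟩ := h ((A.iCycles (i + 1)).hom c) (by
    rw [← LinearMap.comp_apply, ← ModuleCat.hom_comp, HomologicalComplex.iCycles_d]
    rfl)
  have hc : (HomologicalComplex.cyclesMap f (i + 1)).hom c =
      (B.toCycles (i + 2) (i + 1)).hom b := by
    apply (ModuleCat.mono_iff_injective (B.iCycles (i + 1))).mp inferInstance
    change (B.iCycles (i + 1)).hom _ = (B.iCycles (i + 1)).hom _
    rw [← LinearMap.comp_apply, ← LinearMap.comp_apply, ← ModuleCat.hom_comp,
      ← ModuleCat.hom_comp, HomologicalComplex.cyclesMap_i, HomologicalComplex.toCycles_i, hb]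
    rfl
  rw [ModuleCat.hom_comp, LinearMap.comp_apply, hc, ← LinearMap.comp_apply, ← ModuleCat.hom_comp,
    HomologicalComplex.toCycles_comp_homologyπ]
  rfl

theorem tor_map_eq_zero_of_koszulTrivial {S : Type u} [CommRing S] {n : ℕ} {y : Fin n → S}
    (hacyclic : ∀ (P : Type u) [AddCommGroup P] [Module S P] [Module.Projective S P],
      KoszulAcyclic y P)
    {M N : ModuleCat.{u} S} (g : M ⟶ N) (hg : KoszulTrivial y g.hom) (i : ℕ) :
    ((Tor (ModuleCat.{u} S) (i + 1)).obj
      (ModuleCat.of S (S ⧸ Ideal.span (Set.range y)))).map g = 0 := by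
  set m := Ideal.span (Set.range y) with hm
  let P := projectiveResolution M
  let Q := projectiveResolution N
  let φ := ProjectiveResolution.lift g P Q
  rw [Tor_obj, Functor.leftDerived_map_eq _ _ g φ (ProjectiveResolution.lift_commutes g P Q)]
  suffices h : (((MonoidalCategory.tensoringLeft (ModuleCat.{u} S)).obj
        (ModuleCat.of S (S ⧸ m))).mapHomologicalComplex _ ⋙
          HomologicalComplex.homologyFunctor _ _ (i + 1)).map φ = 0 by
    rw [h, Limits.zero_comp, Limits.comp_zero]
  apply homologyMap_eq_zero_of_forall_cycle
  intro t ht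
  obtain ⟨x, rfl⟩ := exists_one_tmul_eq m t
  have hx : (P.complex.d (i + 1) i).hom x ∈ m • (⊤ : Submodule S (P.complex.X i)) :=
    (one_tmul_eq_zero_iff m _).mp ht
  have hproj : ∀ k, Module.Projective S (P.complex.X k) := fun k =>
    (IsProjective.iff_projective _).mpr (P.projective k)
  obtain ⟨q, hq⟩ := exists_sub_mem_of_koszulTrivial (P := fun k => P.complex.X k)
    (Q := fun k => Q.complex.X k) (dP := fun k => (P.complex.d (k + 1) k).hom)
    (dQ := fun k => (Q.complex.d (k + 1) k).hom) (εP := (P.π.f 0).hom) (εQ := (Q.π.f 0).hom)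
    (φ := fun k => (φ.f k).hom) hg (fun k => hacyclic _)
    (fun k x => by
      rw [← LinearMap.comp_apply, ← ModuleCat.hom_comp, P.complex.d_comp_d]; rfl)
    (fun x => by
      rw [← LinearMap.comp_apply, ← ModuleCat.hom_comp, P.complex_d_comp_π_f_zero]; rfl)
    (fun k => (ShortComplex.ShortExact.moduleCat_exact_iff_function_exact _).mp (Q.exact_succ k))
    ((ShortComplex.ShortExact.moduleCat_exact_iff_function_exact _).mp Q.exact₀)
    ((ModuleCat.epi_iff_surjective (Q.π.f 0)).mp inferInstance)
    (fun k x => by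
      rw [← LinearMap.comp_apply, ← LinearMap.comp_apply, ← ModuleCat.hom_comp,
        ← ModuleCat.hom_comp, φ.comm])
    (fun x => by
      have := ProjectiveResolution.lift_commutes_zero g P Q
      exact LinearMap.congr_fun (congrArg ModuleCat.Hom.hom this) x)
    i x hx
  rw [← hm] at hq
  refine ⟨(1 : S ⧸ m) ⊗ₜ[S] q, ?_⟩
  have := (one_tmul_eq_zero_iff m _).mpr hq
  rw [TensorProduct.tmul_sub, sub_eq_zero] at this
  exact this.symm

theorem SuccessiveQuotients.torQuotientMap_eq_zero {S : Type u} [CommRing S] {n : ℕ}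
    {y : Fin n → S} (Q : SuccessiveQuotients y) {G : Set S} (hG : ∀ f ∈ G, Q.E n f = 0)
    {m I J : Ideal S} (hm : m = Ideal.span (Set.range y)) (hI : I = Ideal.span G)
    (hJ : J = Ideal.span {g | ∃ f ∈ G, ∃ r, g = Q.D r f}) (h : I ≤ J) (i : ℕ) (hi : 1 ≤ i) :
    torQuotientMap m h i = 0 := by
  subst hm hI hJ
  obtain ⟨i, rfl⟩ := Nat.exists_eq_succ_of_ne_zero (Nat.one_le_iff_ne_zero.mp hi)
  exact tor_map_eq_zero_of_koszulTrivial (fun P => Q.koszulAcyclic_of_projective P) _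
    (Q.koszulTrivial_factor h fun r f hf => Q.D_mem hG r hf) i

end Tor

/-! ### Power series as an instance. -/

namespace PowerSeriesCase

variable {K : Type u} [Field K] {n : ℕ}

/-- `zeroBelow r` as a ring homomorphism. -/
noncomputable def zeroBelowHom (K : Type u) [Field K] (n r : ℕ) :
    MvPowerSeries (Fin n) K →+* MvPowerSeries (Fin n) K :=
  MvPowerSeries.rescale fun j : Fin n => if r ≤ (j : ℕ) then (1 : K) else 0

theorem zeroBelowHom_apply (r : ℕ) (f : MvPowerSeries (Fin n) K) :
    zeroBelowHom K n r f = zeroBelow r f := by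
  rw [zeroBelowHom, MvPowerSeries.rescale_eq_subst, zeroBelow]
  congr 1
  funext j
  by_cases hj : r ≤ (j : ℕ) <;> simp [hj]

theorem zeroBelow_X (r : ℕ) (j : Fin n) :
    zeroBelow r (MvPowerSeries.X j : MvPowerSeries (Fin n) K) =
      if r ≤ (j : ℕ) then MvPowerSeries.X j else 0 := by
  ext m
  rw [coeff_zeroBelow, MvPowerSeries.coeff_X]
  split_ifs with h1 h2 h3 h4 h5
  · rw [MvPowerSeries.coeff_X, if_pos h2]
  · subst h2
    simpa using h1 j (by omega)
  · rw [MvPowerSeries.coeff_X, if_neg h2]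
  · rfl
  · rw [MvPowerSeries.coeff_X, if_neg]
    rintro rfl
    refine h1 fun k hk => ?_
    rw [Finsupp.single_eq_of_ne]
    rintro rfl
    omega
  · rfl

theorem zeroBelow_eq_C (f : MvPowerSeries (Fin n) K) :
    zeroBelow n f = MvPowerSeries.C (MvPowerSeries.constantCoeff f) := by
  ext m
  rw [coeff_zeroBelow, MvPowerSeries.coeff_C]
  by_cases hm : m = 0
  · subst hm
    simp
  · rw [if_neg hm, if_neg]
    exact fun h => hm (Finsupp.ext fun j => h j j.isLt)

/-- The operators `d_σ^r`, with respect to the variables in the order given by `σ`. -/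
noncomputable def successiveQuotients (σ : Equiv.Perm (Fin n)) :
    SuccessiveQuotients fun j => (MvPowerSeries.X (σ j) : MvPowerSeries (Fin n) K) where
  E r := (MvPowerSeries.renameEquiv K σ : _ →+* _).comp
    ((zeroBelowHom K n r).comp (MvPowerSeries.renameEquiv K σ.symm : _ →+* _))
  D := dPerm σ
  E_zero f := by
    have h : ∀ f : MvPowerSeries (Fin n) K, zeroBelow 0 f = f := fun f => by
      ext m
      simp [coeff_zeroBelow]
    simp [zeroBelowHom_apply, h, ← MvPowerSeries.renameEquiv_symm]
  E_var r j := by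
    simp only [RingHom.comp_apply, RingHom.coe_coe, zeroBelowHom_apply]
    change MvPowerSeries.rename σ
      (zeroBelow r (MvPowerSeries.rename σ.symm (MvPowerSeries.X (σ j)))) = _
    rw [MvPowerSeries.rename_X, Equiv.symm_apply_apply, zeroBelow_X]
    split_ifs <;> simp
  mul_D r f := by
    simp only [RingHom.comp_apply, RingHom.coe_coe, zeroBelowHom_apply]
    rw [← map_sub, ← X_mul_d, map_mul, dPerm]
    simp
  regular r := by
    refine (IsRegular.of_ne_zero fun h => ?_).left
    have := congrArg (MvPowerSeries.coeff (Finsupp.single (σ r) 1)) h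
    simp [MvPowerSeries.coeff_X] at this

theorem successiveQuotients_E_eq_zero (σ : Equiv.Perm (Fin n)) {f : MvPowerSeries (Fin n) K}
    (hf : MvPowerSeries.constantCoeff f = 0) : (successiveQuotients σ).E n f = 0 := by
  change MvPowerSeries.renameEquiv K σ
    (zeroBelowHom K n n (MvPowerSeries.renameEquiv K σ.symm f)) = 0
  rw [zeroBelowHom_apply, zeroBelow_eq_C]
  simp [MvPowerSeries.constantCoeff_rename, hf]

theorem constantCoeff_eq_zero_of_mem {I : Ideal (MvPowerSeries (Fin n) K)} (hI : I ≠ ⊤)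
    {f : MvPowerSeries (Fin n) K} (hf : f ∈ I) : MvPowerSeries.constantCoeff f = 0 := by
  by_contra h
  exact hI (I.eq_top_of_isUnit_mem hf (MvPowerSeries.isUnit_iff_constantCoeff.mpr (Ne.isUnit h)))

end PowerSeriesCase

/-! ### Polynomials as an instance. -/

namespace PolynomialCase

variable {K : Type u} [Field K] {n : ℕ}

attribute [local instance] MvPolynomial.gradedAlgebra

theorem zeroBelow_eq_C (f : MvPolynomial (Fin n) K) :
    zeroBelow n f = MvPolynomial.C (MvPolynomial.constantCoeff f) := by
  have h : (fun j : Fin n => if n ≤ (j : ℕ) then (MvPolynomial.X j : MvPolynomial (Fin n) K) else 0)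
      = fun _ => 0 := funext fun j => if_neg j.isLt.not_ge
  rw [zeroBelow, h, MvPolynomial.aeval_zero']
  rfl

/-- The operators `d_σ^r`, with respect to the variables in the order given by `σ`. -/
noncomputable def successiveQuotients (σ : Equiv.Perm (Fin n)) :
    SuccessiveQuotients fun j => (MvPolynomial.X (σ j) : MvPolynomial (Fin n) K) where
  E r := RingHomClass.toRingHom ((MvPolynomial.rename σ).comp
    ((MvPolynomial.aeval fun j : Fin n =>
      if r ≤ (j : ℕ) then (MvPolynomial.X j : MvPolynomial (Fin n) K) else 0).comp
        (MvPolynomial.rename (R := K) σ.symm)))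
  D := dPerm σ
  E_zero f := by
    simp [MvPolynomial.rename_rename]
  E_var r j := by
    rw [RingHom.coe_coe, AlgHom.comp_apply, AlgHom.comp_apply, MvPolynomial.rename_X,
      Equiv.symm_apply_apply, MvPolynomial.aeval_X]
    split_ifs <;> simp
  mul_D r f := by
    change _ = MvPolynomial.renameEquiv K σ (zeroBelow r (MvPolynomial.renameEquiv K σ.symm f)) -
      MvPolynomial.renameEquiv K σ (zeroBelow (r + 1) (MvPolynomial.renameEquiv K σ.symm f))
    rw [← map_sub, ← X_mul_d, map_mul, dPerm]
    simp
  regular r := (IsRegular.of_ne_zero (MvPolynomial.X_ne_zero _)).left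

theorem successiveQuotients_E_eq_zero (σ : Equiv.Perm (Fin n)) {f : MvPolynomial (Fin n) K}
    (hf : MvPolynomial.constantCoeff f = 0) : (successiveQuotients σ).E n f = 0 := by
  change MvPolynomial.renameEquiv K σ (zeroBelow n (MvPolynomial.renameEquiv K σ.symm f)) = 0
  rw [zeroBelow_eq_C]
  simp [MvPolynomial.constantCoeff_rename, hf]

/-- The degree-zero component of `f` stays in a graded ideal, and a nonzero constant would be a
unit. Without grading this fails, for instance for `(x - 1)`. -/
theorem constantCoeff_eq_zero_of_mem {I : Ideal (MvPolynomial (Fin n) K)} (hgr : IsGraded I)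
    (hI : I ≠ ⊤) {f : MvPolynomial (Fin n) K} (hf : f ∈ I) : MvPolynomial.constantCoeff f = 0 := by
  by_contra h
  have h0 := hgr 0 hf
  rw [← DirectSum.Decomposition.decompose'_eq, MvPolynomial.decomposition.decompose'_apply,
    MvPolynomial.homogeneousComponent_zero] at h0
  exact hI (I.eq_top_of_isUnit_mem h0 ((Ne.isUnit h).map MvPolynomial.C))

end PolynomialCase

theorem corollary2p2 {K : Type u} [Field K] {n : ℕ} (σ : Equiv.Perm (Fin n)) :
    (∀ (I : Ideal (MvPowerSeries (Fin n) K)) (G : Set (MvPowerSeries (Fin n) K)),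
      I ≠ ⊤ → Ideal.span G = I →
        ∃ h : I ≤ PowerSeriesCase.dIdeal σ G,
          ∀ i : ℕ, 1 ≤ i → torQuotientMap (PowerSeriesCase.maxIdeal K n) h i = 0) ∧
    (∀ (I : Ideal (MvPolynomial (Fin n) K)) (G : Set (MvPolynomial (Fin n) K)),
      PolynomialCase.IsGraded I → I ≠ ⊤ → Ideal.span G = I →
        ∃ h : I ≤ PolynomialCase.dIdeal σ G,
          ∀ i : ℕ, 1 ≤ i → torQuotientMap (PolynomialCase.maxIdeal K n) h i = 0) := by
  refine ⟨fun I G hI hG => ?_, fun I G hgr hI hG => ?_⟩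
  · have hE : ∀ f ∈ G, (PowerSeriesCase.successiveQuotients σ).E n f = 0 := fun f hf =>
      PowerSeriesCase.successiveQuotients_E_eq_zero σ
        (PowerSeriesCase.constantCoeff_eq_zero_of_mem hI (hG ▸ Ideal.subset_span hf))
    refine ⟨hG ▸ (PowerSeriesCase.successiveQuotients σ).span_le hE, fun i hi =>
      (PowerSeriesCase.successiveQuotients σ).torQuotientMap_eq_zero hE ?_ hG.symm rfl _ i hi⟩
    -- Reordering the variables by `σ` does not change the ideal they generate.
    exact congrArg Ideal.span (σ.surjective.range_comp MvPowerSeries.X).symm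
  · have hE : ∀ f ∈ G, (PolynomialCase.successiveQuotients σ).E n f = 0 := fun f hf =>
      PolynomialCase.successiveQuotients_E_eq_zero σ
        (PolynomialCase.constantCoeff_eq_zero_of_mem hgr hI (hG ▸ Ideal.subset_span hf))
    refine ⟨hG ▸ (PolynomialCase.successiveQuotients σ).span_le hE, fun i hi =>
      (PolynomialCase.successiveQuotients σ).torQuotientMap_eq_zero hE ?_ hG.symm rfl _ i hi⟩
    exact congrArg Ideal.span (σ.surjective.range_comp MvPolynomial.X).symm
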